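/- All groups are Abelian, and $\mathbb T$ is the multiplicative group of complex numbers of modulus one. A subset of a topological space is $G_\delta$-dense if it meets every nonempty $G_\delta$-set. For an infinite cardinal $\sigma$, let $m(\sigma)$ be the least cardinality of a $G_\delta$-dense subset of a compact group of weight $\sigma$; it does not depend on the group, and we take the group $\mathbb T^\sigma$. A subset of an Abelian group is independent if its elements satisfy no nontrivial relation with integer coefficients. A topological group $A$ has property $\sharp h$ if, for every countable subgroup $N$ of $A$, every (not necessarily continuous) homomorphism $N\to\mathbb T$ extends to a continuous homomorphism $A\to\mathbb T$. For $\chi\colon G\to\mathbb T$, let $\chi^\sigma\colon G^\sigma\to\mathbb T^\sigma$ be the map acting as $\chi$ on every coordinate. Let $\chi\colon G\to\mathbb T$ be a surjective continuous character of a compact metrizable Abelian group $G$, and let $\sigma$ and $\alpha$ be cardinals with $m(\sigma)\le\alpha$ and $\alpha^{\omega}\le\sigma$. Then the topological group $G^\sigma$ contains an independent $G_\delta$-dense subset $F$ of cardinality $\alpha$ such that $\chi^\sigma$ restricts to a group isomorphism from $\langle F\rangle$ onto $\langle\chi^\sigma(F)\rangle$ (so $F$ and $\chi^\sigma(F)$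 generate isomorphic groups), and both $\langle F\rangle$ and $\langle\chi^\sigma(F)\rangle$, with the topologies inherited from $G^\sigma$ and $\mathbb T^\sigma$, have property $\sharp h$. -/

import Mathlib

open scoped Cardinal

universe u v

/-- A subset of a topological space is `G_δ`-dense if it meets every nonempty `G_δ`-set. -/
def IsGdDense {X : Type*} [TopologicalSpace X] (D : Set X) : Prop :=
  ∀ U : Set X, IsGδ U → U.Nonempty → (U ∩ D).Nonempty

/-- The cardinal function `m(σ)`: the least cardinality of a `G_δ`-dense subset of a compact
group of weight `σ`, for infinite `σ`.  The value does not depend on the group that is chosen;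
we take the power `𝕋^σ` of the circle group, which is compact and has weight `σ`. -/
noncomputable def mCard (σ : Cardinal.{u}) : Cardinal.{u} :=
  sInf {κ : Cardinal.{u} | ∃ D : Set (σ.out → Circle), IsGdDense D ∧ #D = κ}

/-- A subset of a (multiplicatively written) Abelian group is independent if it satisfies no
nontrivial relation `x₁ ^ n₁ * ⋯ * xₖ ^ nₖ = 1` with distinct `xᵢ` and integers `nᵢ`, i.e. if it
freely generates a free Abelian group. -/
def IsIndependent {A : Type*} [CommGroup A] (F : Set A) : Prop :=
  LinearIndependent ℤ (fun x : F => Additive.ofMul (x : A))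

/-- The subgroup `H` is `h`-embedded in the topological group `A` if every (not necessarily
continuous) homomorphism of `H` to the circle extends to a continuous homomorphism of `A`. -/
def IsHEmbedded {A : Type*} [CommGroup A] [TopologicalSpace A] (H : Subgroup A) : Prop :=
  ∀ φ : H →* Circle, ∃ ψ : A →* Circle, Continuous ψ ∧ ∀ x : H, ψ (x : A) = φ x

/-- Property `♯h`: every countable subgroup is `h`-embedded. -/
def HasSharpH (A : Type*) [CommGroup A] [TopologicalSpace A] : Prop :=
  ∀ N : Subgroup A, (N : Set A).Countable → IsHEmbedded N

/-- The coordinatewise power `χ^ι : G^ι → 𝕋^ι` of a homomorphism `χ : G → 𝕋`. -/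
noncomputable def powerHom (ι : Type u) {G : Type v} [CommGroup G] (χ : G →* Circle) :
    (ι → G) →* (ι → Circle) :=
  χ.compLeft ι

/-! Since `α ^ ℵ₀ ≤ σ`, the sequences in `A × Circle`, with `#A = α`, can be given distinct
coordinates. Take `α` copies of each point of a dense set and, at the coordinate of a sequence,
alter only the members it lists, so as to prescribe their values under `χ`
(`exists_interpolating_family`). Coordinate characters then realize every circle-valued function on
countably many members, both in the power of `G` and after applying `χ`; this yields independence
and `♯h`. Countably many coordinates disturb only countably many members and `α` is uncountable, so
each point keeps an untouched copy there and density survives. -/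

/-- Every point of a power agrees on countably many coordinates with a member of a
`G_δ`-dense set. -/
theorem IsGdDense.exists_eq_on_countable {ι X : Type*} [TopologicalSpace X]
    [FirstCountableTopology X] [T1Space X] {D : Set (ι → X)} (hD : IsGdDense D) {J : Set ι}
    (hJ : J.Countable) (y : ι → X) : ∃ x ∈ D, ∀ i ∈ J, x i = y i := by
  have hG : IsGδ (⋂ i ∈ J, (fun x : ι → X => x i) ⁻¹' {y i}) :=
    IsGδ.biInter hJ fun i _ => (IsGδ.singleton (y i)).preimage (continuous_apply i)
  obtain ⟨x, hx, hxD⟩ := hD _ hG ⟨y, by simp⟩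
  exact ⟨x, hxD, by simpa using hx⟩

/-- A set meeting every countable coordinate condition is `G_δ`-dense in a power. -/
theorem isGdDense_of_exists_eq_on_countable {ι X : Type*} [TopologicalSpace X]
    {D : Set (ι → X)}
    (h : ∀ J : Set ι, J.Countable → ∀ y : ι → X, ∃ x ∈ D, ∀ i ∈ J, x i = y i) :
    IsGdDense D := by
  rintro U hU ⟨y, hy⟩
  obtain ⟨f, hf, rfl⟩ := isGδ_iff_eq_iInter_nat.1 hU
  rw [Set.mem_iInter] at hy
  choose I u hu hI using fun n => isOpen_pi_iff.1 (hf n) y (hy n)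
  obtain ⟨x, hxD, hx⟩ := h (⋃ n, (I n : Set ι))
    (Set.countable_iUnion fun n => (I n).countable_toSet) y
  refine ⟨x, Set.mem_iInter.2 fun n => hI n fun i hi => ?_, hxD⟩
  rw [hx i (Set.mem_iUnion.2 ⟨n, hi⟩)]
  exact (hu n i hi).2

noncomputable instance Circle.divisibleByInt : DivisibleBy (Additive Circle) ℤ :=
  Function.Surjective.divisibleBy (Circle.expHom : ℝ →+ Additive Circle)
    (fun z => Circle.exp_surjective z.toMul) fun a n => map_zsmul Circle.expHom n a

/-- Homomorphisms from a subgroup to the circle extend to the whole group. -/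
theorem Subgroup.exists_extend_circle {A : Type*} [CommGroup A] (N : Subgroup A)
    (φ : N →* Circle) : ∃ ψ : A →* Circle, ∀ x : N, ψ x = φ x := by
  obtain ⟨h, hh⟩ := (Module.Baer.of_divisible (Additive Circle)).extension_property_addMonoidHom
    (MonoidHom.toAdditive N.subtype) Subtype.coe_injective (MonoidHom.toAdditive φ)
  exact ⟨MonoidHom.toAdditive.symm h, fun x => DFunLike.congr_fun hh (Additive.ofMul x)⟩

/-- Characters on the subgroup generated by a family are determined at each element by their
values at countably many members of the family. -/
theorem Subgroup.exists_countable_determining {A B : Type*} [CommGroup B] (x : A → B)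
    (y : Subgroup.closure (Set.range x)) :
    ∃ C : Set A, C.Countable ∧ ∀ φ ψ : Subgroup.closure (Set.range x) →* Circle,
      (∀ a ∈ C, φ ⟨x a, Subgroup.subset_closure ⟨a, rfl⟩⟩ =
        ψ ⟨x a, Subgroup.subset_closure ⟨a, rfl⟩⟩) → φ y = ψ y := by
  obtain ⟨y, hy⟩ := y
  induction hy using Subgroup.closure_induction with
  | mem y hy =>
    obtain ⟨a, rfl⟩ := hy
    exact ⟨{a}, Set.countable_singleton a, fun φ ψ h => h a rfl⟩
  | one => exact ⟨∅, Set.countable_empty, fun φ ψ _ => (map_one φ).trans (map_one ψ).symm⟩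
  | mul y z hy hz ihy ihz =>
    obtain ⟨C, hC, h⟩ := ihy
    obtain ⟨D, hD, k⟩ := ihz
    refine ⟨C ∪ D, hC.union hD, fun φ ψ e => ?_⟩
    have := congrArg₂ (· * ·) (h φ ψ fun a ha => e a (Or.inl ha))
      (k φ ψ fun a ha => e a (Or.inr ha))
    simp only [← map_mul] at this
    exact this
  | inv y hy ih =>
    obtain ⟨C, hC, h⟩ := ih
    refine ⟨C, hC, fun φ ψ e => ?_⟩
    have := congrArg (·⁻¹) (h φ ψ e)
    simp only [← map_inv] at this
    exact this

/-- Every circle-valued function on countably many members of the family `x` is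
the restriction of a continuous character. -/
def InterpolatesCountably {A B : Type*} [CommGroup B] [TopologicalSpace B] (x : A → B) : Prop :=
  ∀ (C : Set A) (f : A → Circle), C.Countable →
    ∃ ψ : B →* Circle, Continuous ψ ∧ ∀ a ∈ C, ψ (x a) = f a

namespace InterpolatesCountably

variable {A B : Type*} [CommGroup B] [TopologicalSpace B] {x : A → B}

theorem linearIndependent (hx : InterpolatesCountably x) :
    LinearIndependent ℤ fun a => Additive.ofMul (x a) := by
  classical
  rw [linearIndependent_iff']
  intro s g hs a ha
  by_contra hga
  -- Applied to the relation, this character gives `exp(πi) = 1`.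
  obtain ⟨ψ, -, hψ⟩ := hx s (fun b => if b = a then Circle.exp (Real.pi / g a) else 1)
    s.countable_toSet
  have h1 : ∏ b ∈ s, x b ^ g b = 1 := by
    simpa using congrArg Additive.toMul hs
  have h2 : ∏ b ∈ s, ψ (x b) ^ g b = 1 := by
    simpa using congrArg ψ h1
  have h3 : ∏ b ∈ s, ψ (x b) ^ g b = Circle.exp (Real.pi / g a) ^ g a := by
    rw [Finset.prod_eq_single_of_mem a ha]
    · rw [hψ a ha, if_pos rfl]
    · intro b hb hba
      rw [hψ b hb, if_neg hba, one_zpow]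
  have h4 : Circle.exp (Real.pi / g a) ^ g a = Circle.exp Real.pi := by
    rw [← Circle.exp_zsmul, zsmul_eq_mul, mul_div_cancel₀]
    exact_mod_cast hga
  rw [h3, h4] at h2
  have h5 : ((Circle.exp Real.pi : Circle) : ℂ) = 1 := by rw [h2, Circle.coe_one]
  rw [Circle.coe_exp, Complex.exp_pi_mul_I] at h5
  norm_num at h5

theorem isIndependent_range (hx : InterpolatesCountably x) : IsIndependent (Set.range x) := by
  have h := hx.linearIndependent
  have hinj : Function.Injective x := fun a b hab => h.injective (congrArg Additive.ofMul hab)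
  exact (linearIndependent_equiv (Equiv.ofInjective x hinj)).1 h

/-- The circle is divisible, so `φ` extends abstractly to the closure; a countable `N` involves only
countably many generators, and a continuous character need match the extension only there. -/
theorem hasSharpH_closure (hx : InterpolatesCountably x) :
    HasSharpH (Subgroup.closure (Set.range x)) := by
  intro N hN φ
  obtain ⟨φ', hφ'⟩ := N.exists_extend_circle φ
  choose C hC hdet using Subgroup.exists_countable_determining x
  obtain ⟨ψ, hψ, hψx⟩ := hx (⋃ y ∈ N, C y)
    (fun a => φ' ⟨x a, Subgroup.subset_closure ⟨a, rfl⟩⟩) (hN.biUnion fun y _ => hC y)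
  refine ⟨ψ.comp (Subgroup.subtype _), hψ.comp continuous_subtype_val, fun y => ?_⟩
  rw [← hφ' y]
  exact hdet y _ _ fun a ha => hψx a (Set.mem_biUnion y.2 ha)

end InterpolatesCountably

/-- A homomorphism sending a family to a linearly independent one is injective on the subgroup
generated by the family. -/
theorem exists_mulEquiv_closure_image {A B B' : Type*} [CommGroup B] [CommGroup B'] (x : A → B)
    (p : B →* B') (h : LinearIndependent ℤ fun a => Additive.ofMul (p (x a))) :
    ∃ e : Subgroup.closure (Set.range x) ≃* Subgroup.closure (p '' Set.range x),
      ∀ y : Subgroup.closure (Set.range x), (e y : B') = p y := by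
  have hker : ∀ y ∈ Subgroup.closure (Set.range x), p y = 1 → y = 1 := by
    intro y hy hpy
    obtain ⟨c, rfl⟩ := Subgroup.exists_finsupp_of_mem_closure_range x y hy
    have h0 : c = 0 := by
      refine (linearIndependent_iff.1 h) c ?_
      have := congrArg Additive.ofMul hpy
      simpa [Finsupp.linearCombination_apply, Finsupp.prod, Finsupp.sum] using this
    simp [h0]
  have hmap : (Subgroup.closure (Set.range x)).map p = Subgroup.closure (p '' Set.range x) :=
    MonoidHom.map_closure p _
  have hinj : Function.Injective (p.subgroupMap (Subgroup.closure (Set.range x))) := by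
    rw [injective_iff_map_eq_one]
    exact fun y hy => Subtype.ext (hker y y.2 (congrArg Subtype.val hy))
  exact ⟨(MulEquiv.ofBijective _ ⟨hinj, p.subgroupMap_surjective _⟩).trans
    (MulEquiv.subgroupCongr hmap), fun y => rfl⟩

theorem Circle.mk_eq_continuum : #Circle = 𝔠 :=
  (Cardinal.mk_congr Circle.argEquiv).trans
    (Cardinal.mk_Ioc_real (neg_lt_self Real.pi_pos))

/-- A nonempty compact metrizable space is an image of the circle under some map of sets. -/
theorem exists_surjective_circle_of_compact_metrizable {X : Type*} [TopologicalSpace X]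
    [CompactSpace X] [TopologicalSpace.MetrizableSpace X] [Nonempty X] :
    ∃ g : Circle → X, Function.Surjective g := by
  let := TopologicalSpace.metrizableSpaceMetric X
  obtain ⟨b, hbc, -, hb⟩ := TopologicalSpace.exists_countable_basis X
  have : Countable b := hbc
  obtain ⟨k, hk⟩ := exists_injective_nat b
  -- A point is coded by the basic open sets containing it, whence `#X ≤ 𝔠`.
  let m : X → Set ℕ := fun x => {n | ∃ s : b, x ∈ (s : Set X) ∧ k s = n}
  have hm : Function.Injective m := by
    intro x y hxy
    refine (hb.eq_iff).2 fun s hs => ?_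
    have h : ∀ z, z ∈ s ↔ k ⟨s, hs⟩ ∈ m z := fun z =>
      ⟨fun hz => ⟨⟨s, hs⟩, hz, rfl⟩, fun ⟨t, ht, hkt⟩ => by rw [hk hkt] at ht; exact ht⟩
    rw [h, h, hxy]
  have hc : #(Set ℕ) ≤ #Circle := by
    rw [Circle.mk_eq_continuum, Cardinal.mk_set, Cardinal.mk_nat, Cardinal.two_power_aleph0]
  obtain ⟨q⟩ := hc
  exact ⟨Function.invFun fun x => q (m x), Function.invFun_surjective (q.injective.comp hm)⟩

/-- A family of points of a power can be changed, at only countably many members for each countable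
set of coordinates, so that coordinates realize all prescribed values on countable subfamilies. -/
theorem exists_interpolating_family {A ι X : Type*} [Nonempty A] (p : X → Circle)
    (hp : Function.Surjective p) (j : (ℕ → A × Circle) ↪ ι) (d : A → ι → X) :
    ∃ x : A → ι → X,
      (∀ (C : Set A) (f : A → Circle), C.Countable → ∃ i, ∀ a ∈ C, p (x a i) = f a) ∧
      ∀ J : Set ι, J.Countable → {a | ∃ i ∈ J, x a i ≠ d a i}.Countable := by
  classical
  obtain ⟨q, hq⟩ := hp.hasRightInverse
  let P : A → ι → Prop := fun a i => ∃ (s : ℕ → A × Circle) (n : ℕ), j s = i ∧ (s n).1 = a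
  let x : A → ι → X := fun a i =>
    if h : P a i then q (h.choose h.choose_spec.choose).2 else d a i
  refine ⟨x, fun C f hC => ?_, fun J hJ => ?_⟩
  · rcases C.eq_empty_or_nonempty with rfl | hne
    · exact ⟨j fun _ => (Classical.arbitrary A, 1), by simp⟩
    obtain ⟨t, rfl⟩ := hC.exists_eq_range hne
    refine ⟨j fun n => (t n, f (t n)), ?_⟩
    rintro _ ⟨n, rfl⟩
    have h : P (t n) (j fun n => (t n, f (t n))) := ⟨_, n, rfl, rfl⟩
    have h1 := j.injective h.choose_spec.choose_spec.1
    have h2 := h.choose_spec.choose_spec.2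
    simp only [x, dif_pos h, hq _]
    -- `t` may repeat, so the chosen index need not be `n`; the prescribed value depends only on the
    -- member listed.
    generalize h.choose_spec.choose = m at h2 ⊢
    rw [h1] at h2 ⊢
    exact congrArg f h2
  · refine ((hJ.preimage j.injective).biUnion
      fun s _ => Set.countable_range fun n => (s n).1).mono ?_
    rintro a ⟨i, hi, hai⟩
    by_cases h : P a i
    · obtain ⟨s, n, rfl, rfl⟩ := h
      exact Set.mem_biUnion (Set.mem_preimage.2 hi) ⟨n, rfl⟩
    · exact absurd (dif_neg h) hai

theorem mainTheorem9 {G : Type v} [CommGroup G] [TopologicalSpace G] [IsTopologicalGroup G]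
    [CompactSpace G] [TopologicalSpace.MetrizableSpace G]
    (χ : G →* Circle) (hχ_cont : Continuous χ) (hχ_surj : Function.Surjective χ)
    (σ α : Cardinal.{u}) (hm : mCard σ ≤ α) (hpow : α ^ ℵ₀ ≤ σ)
    (ι : Type u) (hι : #ι = σ) :
    ∃ F : Set (ι → G),
      IsIndependent F ∧
      IsGdDense F ∧
      #F = Cardinal.lift.{v} α ∧
      (∃ e : Subgroup.closure F ≃* Subgroup.closure (powerHom ι χ '' F),
        ∀ x : Subgroup.closure F, (e x : ι → Circle) = powerHom ι χ x) ∧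
      HasSharpH (Subgroup.closure F) ∧
      HasSharpH (Subgroup.closure (powerHom ι χ '' F)) := by
  obtain ⟨D, hD, hDcard⟩ : mCard σ ∈
      {κ : Cardinal.{u} | ∃ D : Set (σ.out → Circle), IsGdDense D ∧ #D = κ} :=
    csInf_mem ⟨_, Set.univ, fun U _ hU => by simpa using hU, rfl⟩
  have hDα : #D ≤ α := hDcard.trans_le hm
  have hDne : D.Nonempty := by
    obtain ⟨x, hx, -⟩ := hD.exists_eq_on_countable Set.countable_empty 1
    exact ⟨x, hx⟩
  have : Nonempty D := hDne.to_subtype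
  have hα0 : α ≠ 0 := fun h => Cardinal.mk_ne_zero D (le_zero_iff.1 (h ▸ hDα))
  have hσ0 : σ ≠ 0 := fun h => Cardinal.power_ne_zero ℵ₀ hα0 (by simpa [h] using hpow)
  obtain ⟨i₀⟩ : Nonempty σ.out := Cardinal.mk_ne_zero_iff.1 (by simpa using hσ0)
  -- One coordinate already maps `D` onto the circle.
  have hc : 𝔠 ≤ α := by
    have hs : Function.Surjective fun x : D => (x : σ.out → Circle) i₀ := by
      intro z
      obtain ⟨x, hx, h⟩ := hD.exists_eq_on_countable (Set.countable_singleton i₀) fun _ => z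
      exact ⟨⟨x, hx⟩, h i₀ rfl⟩
    have h := Cardinal.mk_le_of_surjective (f := fun x : D => ULift.up.{u} (x.1 i₀)) (fun z => by
      obtain ⟨x, hx⟩ := hs z.down
      exact ⟨x, congrArg ULift.up hx⟩)
    have hlift : #(ULift.{u} Circle) = 𝔠 := by
      rw [Cardinal.mk_uLift, Circle.mk_eq_continuum, Cardinal.lift_continuum]
    exact hlift.symm.le.trans (h.trans hDα)
  have hαinf : ℵ₀ ≤ α := Cardinal.aleph0_le_continuum.trans hc
  let A : Type u := α.out × D
  have hA : #A = α := by
    simp only [A, Cardinal.mk_prod, Cardinal.lift_id, Cardinal.mk_out]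
    exact Cardinal.mul_eq_left hαinf hDα (Cardinal.mk_ne_zero D)
  have hj : #(ℕ → A × Circle) ≤ #ι := by
    have hB : #(A × Circle) = α := by
      rw [Cardinal.mk_prod, Circle.mk_eq_continuum, Cardinal.lift_continuum, Cardinal.lift_uzero,
        hA]
      exact Cardinal.mul_eq_left hαinf hc Cardinal.continuum_ne_zero
    rw [hι, Cardinal.mk_arrow, hB, Cardinal.mk_nat, Cardinal.lift_aleph0, Cardinal.lift_uzero]
    exact hpow
  have : Nonempty A := Cardinal.mk_ne_zero_iff.1 (hA ▸ hα0)
  obtain ⟨j⟩ := hj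
  obtain ⟨e⟩ : Nonempty (ι ≃ σ.out) := Cardinal.eq.1 (by simpa using hι)
  -- `g` need not be continuous: density in a power only concerns values at countably many
  -- coordinates.
  obtain ⟨g, hg⟩ := exists_surjective_circle_of_compact_metrizable (X := G)
  obtain ⟨x, hx, hxd⟩ := exists_interpolating_family χ hχ_surj j
    fun (a : A) i => g (a.2.1 (e i))
  have hxG : InterpolatesCountably x := fun C f hC => by
    obtain ⟨i, hi⟩ := hx C f hC
    exact ⟨χ.comp (Pi.evalMonoidHom _ i), hχ_cont.comp (continuous_apply i), hi⟩
  have hxT : InterpolatesCountably fun a => powerHom ι χ (x a) := fun C f hC => by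
    obtain ⟨i, hi⟩ := hx C f hC
    exact ⟨Pi.evalMonoidHom _ i, continuous_apply i, hi⟩
  refine ⟨Set.range x, hxG.isIndependent_range, ?_, ?_,
    exists_mulEquiv_closure_image x (powerHom ι χ) hxT.linearIndependent,
    hxG.hasSharpH_closure, ?_⟩
  · refine isGdDense_of_exists_eq_on_countable fun J hJ y => ?_
    obtain ⟨g', hg'⟩ := hg.hasRightInverse
    obtain ⟨d, hd, hdy⟩ := hD.exists_eq_on_countable (hJ.image e) fun i => g' (y (e.symm i))
    -- A copy of `d` left unaltered on `J`.
    obtain ⟨b, hb⟩ : ∃ b : α.out, (b, (⟨d, hd⟩ : D)) ∉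
        {a : A | ∃ i ∈ J, x a i ≠ g (a.2.1 (e i))} := by
      by_contra! hall
      have hcount : (Set.univ : Set α.out).Countable :=
        ((hxd J hJ).preimage (Prod.mk_left_injective (⟨d, hd⟩ : D))).mono fun b _ => hall b
      have : α ≤ ℵ₀ := by
        rw [← Cardinal.mk_out α]
        exact Cardinal.mk_le_aleph0_iff.2 (Set.countable_univ_iff.1 hcount)
      exact absurd (Cardinal.aleph0_lt_continuum.trans_le hc) this.not_gt
    refine ⟨x (b, ⟨d, hd⟩), ⟨_, rfl⟩, fun i hi => ?_⟩
    have h1 : x (b, ⟨d, hd⟩) i = g (d (e i)) := by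
      by_contra hne
      exact hb ⟨i, hi, hne⟩
    rw [h1, hdy _ ⟨i, hi, rfl⟩, hg', e.symm_apply_apply]
  · have hinj : Function.Injective x := fun a b hab =>
      hxG.linearIndependent.injective (congrArg Additive.ofMul hab)
    have h := Cardinal.mk_range_eq_of_injective hinj
    rw [hA] at h
    refine Cardinal.lift_injective.{u} ?_
    rw [Cardinal.lift_lift]
    exact h.trans (by simp)
  · rw [← Set.range_comp]
    exact hxT.hasSharpH_closure
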